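/- Let $L$ be a finite-dimensional Lie algebra over $\mathbb{F}$, where $\mathbb{F}=\mathbb{R}$ or $\mathbb{F}=\mathbb{C}$. Let $R(L)$ denote the radical of $L$, i.e. the largest solvable ideal of $L$, and let $N(L)$ denote the nilradical of $L$, i.e. the largest ideal of $L$ that is nilpotent as a Lie algebra. If $L$ is perfect, i.e. $L=[L,L]$, where $[L,L]$ is the linear span of all brackets $[x,y]$ with $x,y\in L$, then $R(L)=N(L)$. -/

import Mathlib

section

variable (R L : Type*) [CommRing R] [LieRing L] [LieAlgebra R L]

/-- A Lie algebra `L` is perfect if it equals its derived algebra, `L = [L, L]`. -/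
def IsPerfectLieAlgebra : Prop :=
  ⁅(⊤ : LieIdeal R L), (⊤ : LieIdeal R L)⁆ = ⊤

/-- The nilradical of `L`: the supremum of all ideals of `L` that are nilpotent as Lie algebras
in their own right. It is the largest such ideal when `L` is finite-dimensional over a field,
see `isGreatest_lieNilradical`. (Mathlib's `LieAlgebra.maxNilpotentIdeal` is a different ideal: it
asks for nilpotency as an `L`-module, that is, `[L, [L, … [L, I]]] = 0`.) -/
def lieNilradical : LieIdeal R L :=
  sSup { I : LieIdeal R L | LieRing.IsNilpotent I }

end

/-- A nilpotent ideal acts nilpotently on the whole Lie algebra. -/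
theorem LieIdeal.exists_lcs_eq_bot_of_isNilpotent {R L : Type*} [CommRing R] [LieRing L]
    [LieAlgebra R L] (I : LieIdeal R L) (hI : LieRing.IsNilpotent I) :
    ∃ k, I.lcs L k = ⊥ := by
  rw [LieRing.IsNilpotent, LieModule.isNilpotent_iff R] at hI
  obtain ⟨k, hk⟩ := hI
  have key : ∀ n, ∀ x ∈ I.lcs L (n + 1),
      ∃ y ∈ LieModule.lowerCentralSeries R I I n, (y : L) = x := by
    intro n
    induction n with
    | zero =>
      intro x hx
      have hxI : x ∈ I := by
        rw [LieIdeal.lcs_succ] at hx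
        exact LieSubmodule.lie_le_left _ _ hx
      exact ⟨⟨x, hxI⟩, by simp, rfl⟩
    | succ n ih =>
      intro x hx
      rw [LieIdeal.lcs_succ, ← LieSubmodule.mem_toSubmodule,
        LieSubmodule.lieIdeal_oper_eq_linear_span'] at hx
      induction hx using Submodule.span_induction with
      | mem x hx =>
        obtain ⟨a, ha, b, hb, rfl⟩ := hx
        obtain ⟨y, hy, rfl⟩ := ih b hb
        refine ⟨⁅(⟨a, ha⟩ : I), y⁆, ?_, rfl⟩
        rw [LieModule.lowerCentralSeries_succ]
        exact LieSubmodule.lie_mem_lie (LieSubmodule.mem_top _) hy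
      | zero => exact ⟨0, zero_mem _, rfl⟩
      | add x y _ _ hx hy =>
        obtain ⟨a, ha, rfl⟩ := hx
        obtain ⟨b, hb, rfl⟩ := hy
        exact ⟨a + b, add_mem ha hb, rfl⟩
      | smul c x _ hx =>
        obtain ⟨a, ha, rfl⟩ := hx
        exact ⟨c • a, SMulMemClass.smul_mem c ha, rfl⟩
  refine ⟨k + 1, ?_⟩
  rw [eq_bot_iff]
  intro x hx
  obtain ⟨y, hy, rfl⟩ := key k x hx
  rw [hk, LieSubmodule.mem_bot] at hy
  simp [hy]

/-- The sum of two nilpotent ideals is nilpotent. -/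
theorem LieIdeal.isNilpotent_sup {K L : Type*} [Field K] [LieRing L]
    [LieAlgebra K L] [FiniteDimensional K L] (I J : LieIdeal K L)
    (hI : LieRing.IsNilpotent I) (hJ : LieRing.IsNilpotent J) :
    LieRing.IsNilpotent (I ⊔ J : LieIdeal K L) := by
  obtain ⟨k, hk⟩ := I.exists_lcs_eq_bot_of_isNilpotent hI
  obtain ⟨l, hl⟩ := J.exists_lcs_eq_bot_of_isNilpotent hJ
  have hpow : ∀ x ∈ J, ∀ n, ∀ v : L, ((LieAlgebra.ad K L x) ^ n) v ∈ J.lcs L n := by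
    intro x hx n
    induction n with
    | zero => intro v; simp
    | succ n ih =>
      intro v
      rw [pow_succ', Module.End.mul_apply, LieIdeal.lcs_succ]
      exact LieSubmodule.lie_mem_lie hx (ih v)
  have hnil : ∀ z ∈ I ⊔ J, IsNilpotent (LieAlgebra.ad K L z) := by
    intro z hz
    obtain ⟨x, hx, y, hy, rfl⟩ := (LieSubmodule.mem_sup _ _ _).mp hz
    set f := LieAlgebra.ad K L (x + y) with hf
    set g := LieAlgebra.ad K L y with hg
    have hstab : ∀ j n, ∀ v ∈ I.lcs L j,
        (f ^ n) v ∈ I.lcs L j ∧ (f ^ n) v - (g ^ n) v ∈ I.lcs L (j + 1) := by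
      intro j n v hv
      induction n with
      | zero => simpa using hv
      | succ n ih =>
        have e : (f ^ (n + 1)) v - (g ^ (n + 1)) v =
            ⁅x, (f ^ n) v⁆ + ⁅y, (f ^ n) v - (g ^ n) v⁆ := by
          rw [pow_succ', pow_succ', Module.End.mul_apply, Module.End.mul_apply]
          simp [hf, hg]
          abel
        refine ⟨?_, ?_⟩
        · rw [pow_succ', Module.End.mul_apply]
          exact (I.lcs L j).lie_mem ih.1
        · rw [e]
          refine add_mem ?_ ((I.lcs L (j + 1)).lie_mem ih.2)
          rw [LieIdeal.lcs_succ]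
          exact LieSubmodule.lie_mem_lie hx ih.1
    have hstep : ∀ j, ∀ v : L, (f ^ (l * j)) v ∈ I.lcs L j := by
      intro j
      induction j with
      | zero => intro v; simp
      | succ j ih =>
        intro v
        have h1 := (hstab j l _ (ih v)).2
        have h2 := hpow y hy l ((f ^ (l * j)) v)
        rw [hl, LieSubmodule.mem_bot] at h2
        rw [hg, h2, sub_zero, ← Module.End.mul_apply, ← pow_add] at h1
        rwa [Nat.mul_succ, Nat.add_comm (l * j) l]
    refine ⟨l * k, LinearMap.ext fun v => ?_⟩
    have := hstep k v
    rwa [hk, LieSubmodule.mem_bot] at this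
  rw [LieAlgebra.isNilpotent_iff_forall (R := K)]
  rintro ⟨z, hz⟩
  obtain ⟨n, hn⟩ := hnil z hz
  refine ⟨n, LinearMap.ext fun v => Subtype.ext ?_⟩
  have hcoe : ∀ m, ∀ w : (I ⊔ J : LieIdeal K L),
      ((((LieAlgebra.ad K (I ⊔ J : LieIdeal K L) ⟨z, hz⟩) ^ m) w : (I ⊔ J : LieIdeal K L)) : L) =
        ((LieAlgebra.ad K L z) ^ m) (w : L) := by
    intro m w
    induction m with
    | zero => simp
    | succ m ih =>
      rw [pow_succ', pow_succ', Module.End.mul_apply, Module.End.mul_apply, ← ih]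
      rfl
  rw [hcoe, hn]
  rfl

/-- For a finite-dimensional Lie algebra the nilradical is the largest nilpotent ideal. -/
theorem isGreatest_lieNilradical (K L : Type*) [Field K] [LieRing L]
    [LieAlgebra K L] [FiniteDimensional K L] :
    IsGreatest { I : LieIdeal K L | LieRing.IsNilpotent I } (lieNilradical K L) := by
  refine ⟨?_, fun I hI => le_sSup hI⟩
  have hwf := LieSubmodule.wellFoundedGT_of_noetherian K L L
  rw [← CompleteLattice.isSupClosedCompact_iff_wellFoundedGT] at hwf
  refine hwf { I : LieIdeal K L | LieRing.IsNilpotent I } ⟨⊥, ?_⟩ fun I hI J hJ => ?_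
  · change LieRing.IsNilpotent (⊥ : LieIdeal K L)
    infer_instance
  · exact LieIdeal.isNilpotent_sup I J hI hJ

/-!
The radical of a finite-dimensional Lie algebra `L` over a field of characteristic zero meets
`[L, L]` in elements that act nilpotently on every finite-dimensional `L`-module `M`. Over an
algebraically closed field, Lie's theorem gives a weight `χ` of the radical on `M`, and the
weight space of `χ` is stable under all of `L`; an element of `[L, L]` has trace zero there, so in
characteristic zero `χ` vanishes on it, and induction on the dimension of `M` applies to the
quotient of `M` by that weight space. The general case follows by extending scalars to an algebraic
closure. These are `LieModule.isNilpotent_toEnd_of_mem_of_mem_derivedSeries_of_isAlgClosed` and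
`LieModule.isNilpotent_toEnd_of_mem_of_mem_derivedSeries`.

When `L` is perfect the condition of lying in `[L, L]` is void, so the adjoint action of every
element of the radical is nilpotent, and by Engel's theorem the radical is a nilpotent ideal.
Conversely, nilpotent ideals are solvable. No Levi decomposition is needed.
-/

namespace LieModule

open scoped TensorProduct

attribute [local instance] LieRing.ofAssociativeRing in
theorem trace_toEnd_eq_zero_of_mem_derivedSeries {R L M : Type*} [CommRing R] [LieRing L]
    [LieAlgebra R L] [AddCommGroup M] [Module R M] [LieRingModule L M] [LieModule R L M] {x : L}
    (hx : x ∈ LieAlgebra.derivedSeries R L 1) :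
    LinearMap.trace R M (toEnd R L M x) = 0 := by
  change x ∈ (LieAlgebra.derivedSeries R L 1 : LieSubalgebra R L).toSubmodule at hx
  rw [LieAlgebra.coe_derivedSeries_one_eq] at hx
  induction hx using Submodule.span_induction with
  | mem z hz =>
    obtain ⟨a, b, rfl⟩ := hz
    rw [LieHom.map_lie, LinearMap.trace_lie]
  | zero => simp
  | add a b _ _ ha hb => rw [map_add, map_add, ha, hb, add_zero]
  | smul c a _ ha => rw [map_smul, map_smul, ha, smul_zero]

/-- A solvable ideal has a weight on every nonzero module, and its weight space is stable under the
whole Lie algebra. On `[L, L]` such a weight vanishes, because brackets have trace zero. -/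
theorem exists_lieSubmodule_ne_bot_forall_lie_eq_zero {K L M : Type*} [Field K] [CharZero K]
    [IsAlgClosed K] [LieRing L] [LieAlgebra K L] [AddCommGroup M] [Module K M] [LieRingModule L M]
    [LieModule K L M] [FiniteDimensional K M] [Nontrivial M]
    (I : LieIdeal K L) [LieAlgebra.IsSolvable I] :
    ∃ W : LieSubmodule K L M, W ≠ ⊥ ∧
      ∀ x ∈ I, x ∈ LieAlgebra.derivedSeries K L 1 → ∀ w ∈ W, ⁅x, w⁆ = 0 := by
  obtain ⟨χ, hχ⟩ := exists_nontrivial_weightSpace_of_isSolvable K I M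
  let W : LieSubmodule K L M := weightSpaceOfIsLieTower K M χ
  have hW : ∀ w ∈ W, ∀ y : I, ⁅(y : L), w⁆ = χ y • w := fun w hw y =>
    (mem_weightSpace χ w).mp hw y
  have hWnt : Nontrivial W := hχ
  refine ⟨W, (LieSubmodule.nontrivial_iff_ne_bot K L M).mp hWnt, fun x hxI hx w hw => ?_⟩
  have htr : LinearMap.trace K W (toEnd K L W x) = 0 :=
    trace_toEnd_eq_zero_of_mem_derivedSeries hx
  have hscalar : toEnd K L W x = χ ⟨x, hxI⟩ • LinearMap.id :=
    LinearMap.ext fun v => Subtype.ext (hW v v.2 ⟨x, hxI⟩)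
  rw [hscalar, map_smul, LinearMap.trace_id, smul_eq_mul, mul_eq_zero] at htr
  have hrank : (Module.finrank K W : K) ≠ 0 := Nat.cast_ne_zero.mpr Module.finrank_pos.ne'
  rw [hW w hw ⟨x, hxI⟩, htr.resolve_right hrank, zero_smul]

/-- Over an algebraically closed field of characteristic zero, `I ∩ [L, L]` acts nilpotently on
finite-dimensional modules when `I` is a solvable ideal. -/
theorem isNilpotent_toEnd_of_mem_of_mem_derivedSeries_of_isAlgClosed {K L M : Type*} [Field K]
    [CharZero K] [IsAlgClosed K] [LieRing L] [LieAlgebra K L] [AddCommGroup M] [Module K M]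
    [LieRingModule L M] [LieModule K L M] [FiniteDimensional K M]
    (I : LieIdeal K L) [LieAlgebra.IsSolvable I] {x : L} (hxI : x ∈ I)
    (hx : x ∈ LieAlgebra.derivedSeries K L 1) :
    _root_.IsNilpotent (toEnd K L M x) := by
  obtain _ | _ := subsingleton_or_nontrivial M
  · exact ⟨1, Subsingleton.elim _ _⟩
  obtain ⟨W, hWne, hW⟩ := exists_lieSubmodule_ne_bot_forall_lie_eq_zero (M := M) I
  obtain ⟨n, hn⟩ :=
    isNilpotent_toEnd_of_mem_of_mem_derivedSeries_of_isAlgClosed (M := M ⧸ W) I hxI hx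
  have hmk : ∀ k, ∀ m : M, LieSubmodule.Quotient.mk (N := W) ((toEnd K L M x ^ k) m) =
      (toEnd K L (M ⧸ W) x ^ k) (LieSubmodule.Quotient.mk (N := W) m) := by
    intro k m
    induction k with
    | zero => simp
    | succ k ih =>
      rw [pow_succ', pow_succ', Module.End.mul_apply, Module.End.mul_apply, ← ih]
      rfl
  refine ⟨n + 1, LinearMap.ext fun m => ?_⟩
  rw [pow_succ', Module.End.mul_apply]
  refine hW x hxI hx _ ?_
  rw [← LieSubmodule.Quotient.mk_eq_zero', hmk, hn, LinearMap.zero_apply]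
termination_by Module.finrank K M
decreasing_by
  have : Nontrivial W := (LieSubmodule.nontrivial_iff_ne_bot K L M).mpr hWne
  have hpos : 0 < Module.finrank K W := Module.finrank_pos
  have hadd := W.toSubmodule.finrank_quotient_add_finrank
  change Module.finrank K (M ⧸ W.toSubmodule) < Module.finrank K M
  change 0 < Module.finrank K W.toSubmodule at hpos
  lia

/-- Over a field of characteristic zero, `I ∩ [L, L]` acts nilpotently on finite-dimensional
modules when `I` is a solvable ideal. -/
theorem isNilpotent_toEnd_of_mem_of_mem_derivedSeries {K L M : Type*} [Field K] [CharZero K]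
    [LieRing L] [LieAlgebra K L] [AddCommGroup M] [Module K M] [LieRingModule L M]
    [LieModule K L M] [FiniteDimensional K M]
    (I : LieIdeal K L) [LieAlgebra.IsSolvable I] {x : L} (hxI : x ∈ I)
    (hx : x ∈ LieAlgebra.derivedSeries K L 1) :
    _root_.IsNilpotent (toEnd K L M x) := by
  let A := AlgebraicClosure K
  have hsolv : LieAlgebra.IsSolvable (I.baseChange A) := by
    obtain ⟨k, hk⟩ := LieAlgebra.IsSolvable.solvable K I
    rw [LieIdeal.derivedSeries_eq_bot_iff] at hk
    refine LieAlgebra.IsSolvable.mk (R := A) (k := k) ?_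
    rw [LieIdeal.derivedSeries_eq_bot_iff, LieAlgebra.derivedSeriesOfIdeal_baseChange, hk,
      LieSubmodule.baseChange_bot]
  have hxA : (1 : A) ⊗ₜ[K] x ∈ LieAlgebra.derivedSeries A (A ⊗[K] L) 1 := by
    rw [LieAlgebra.derivedSeries_baseChange]
    exact LieSubmodule.tmul_mem_baseChange_of_mem 1 hx
  have hA : _root_.IsNilpotent (toEnd A (A ⊗[K] L) (A ⊗[K] M) (1 ⊗ₜ x)) :=
    isNilpotent_toEnd_of_mem_of_mem_derivedSeries_of_isAlgClosed (I.baseChange A)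
      (LieSubmodule.tmul_mem_baseChange_of_mem 1 hxI) hxA
  rw [toEnd_baseChange] at hA
  have hinj : Function.Injective (Module.End.baseChangeHom K A M) :=
    LinearMap.baseChangeHom_injective K M A
  exact (IsNilpotent.map_iff hinj).mp hA

end LieModule

theorem corollary2p7 {𝕜 : Type*} [RCLike 𝕜] {L : Type*} [LieRing L] [LieAlgebra 𝕜 L]
    [FiniteDimensional 𝕜 L] (hL : IsPerfectLieAlgebra 𝕜 L) :
    LieAlgebra.radical 𝕜 L = lieNilradical 𝕜 L := by
  refine le_antisymm (le_sSup ?_) (sSup_le fun I hI => ?_)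
  · change LieRing.IsNilpotent (LieAlgebra.radical 𝕜 L)
    rw [LieAlgebra.isNilpotent_iff_forall (R := 𝕜)]
    rintro ⟨x, hx⟩
    have hder : x ∈ LieAlgebra.derivedSeries 𝕜 L 1 := by
      rw [show LieAlgebra.derivedSeries 𝕜 L 1 = ⊤ from hL]
      exact LieSubmodule.mem_top x
    have hnil : IsNilpotent (LieAlgebra.ad 𝕜 L x) :=
      LieModule.isNilpotent_toEnd_of_mem_of_mem_derivedSeries (LieAlgebra.radical 𝕜 L) hx hder
    exact LieSubalgebra.isNilpotent_ad_of_isNilpotent_ad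
      (LieAlgebra.radical 𝕜 L : LieSubalgebra 𝕜 L) (x := ⟨x, hx⟩) hnil
  · have : LieRing.IsNilpotent I := hI
    rw [← LieAlgebra.LieIdeal.solvable_iff_le_radical]
    infer_instance
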